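/- An unlabeled tree is an isomorphism class of finite (nonempty) trees. A rooted tree is a pair $(T,v)$ of a finite tree $T$ and a vertex $v$ of $T$; an isomorphism of rooted trees is a graph isomorphism that takes root to root, and an unlabeled rooted tree is an isomorphism class of rooted trees. The size of a tree or rooted tree is its number of vertices; for each $n$ there are only finitely many unlabeled trees, and only finitely many unlabeled rooted trees, of size $n$. Let $u(x)=\sum_n u_n x^n$ and $r(x)=\sum_n r_n x^n$ in $\mathbb{Q}[[x]]$, where $u_n$ and $r_n$ are the numbers of unlabeled trees and of unlabeled rooted trees of size $n$. Then $$u(x) = r(x) - \frac12\left(r(x)^2 - r(x^2)\right),$$ and $r(x)$ satisfies $$r(x) = x\exp\left(\sum_{k=1}^\infty \frac{r(x^k)}{k}\right),$$ where the sum converges as a sum of formal power series and has constant term $0$. -/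

import Mathlib

open scoped PowerSeries PowerSeries.WithPiTopology

/-- The generating function `∑ a, x ^ s a` of a class `A` of objects with size function `s`:
the coefficient of `x ^ n` is the number of elements of size `n`
(for size functions having finitely many elements of each size). -/
noncomputable def sizeGenFun {A : Type*} (s : A → ℕ) : ℚ⟦X⟧ :=
  PowerSeries.mk fun n => (Nat.card {a : A // s a = n} : ℚ)

/-- A finite tree on an arbitrary vertex set. -/
structure FinTree where
  /-- the vertex set -/
  V : Type
  finite : Finite V
  /-- the underlying simple graph -/
  graph : SimpleGraph V
  isTree : graph.IsTree

/-- A (vertex-)rooted finite tree: a pair consisting of a finite tree and one of its vertices. -/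
structure RootedFinTree where
  /-- the underlying tree -/
  tree : FinTree
  /-- the root -/
  root : tree.V

/-- Two trees are isomorphic if there is a graph isomorphism between them. -/
def FinTree.Isomorphic (T₁ T₂ : FinTree) : Prop :=
  Nonempty (T₁.graph ≃g T₂.graph)

/-- Two rooted trees are isomorphic if there is a graph isomorphism taking root to root. -/
def RootedFinTree.Isomorphic (R₁ R₂ : RootedFinTree) : Prop :=
  ∃ φ : R₁.tree.graph ≃g R₂.tree.graph, φ R₁.root = R₂.root

instance FinTree.isoSetoid : Setoid FinTree where
  r := FinTree.Isomorphic
  iseqv :=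
    { refl := fun _ => ⟨SimpleGraph.Iso.refl⟩
      symm := fun ⟨φ⟩ => ⟨φ.symm⟩
      trans := fun ⟨φ⟩ ⟨ψ⟩ => ⟨φ.trans ψ⟩ }

instance RootedFinTree.isoSetoid : Setoid RootedFinTree where
  r := RootedFinTree.Isomorphic
  iseqv :=
    { refl := fun _ => ⟨SimpleGraph.Iso.refl, rfl⟩
      symm := fun ⟨φ, h⟩ => ⟨φ.symm, by rw [← h]; exact φ.symm_apply_apply _⟩
      trans := fun ⟨φ, h⟩ ⟨ψ, h'⟩ => ⟨φ.trans ψ, by rw [← h', ← h]; rfl⟩ }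

/-- Unlabeled (unrooted) trees: isomorphism classes of finite trees. -/
def UnlabeledTree : Type 1 := Quotient FinTree.isoSetoid

/-- Unlabeled rooted trees: isomorphism classes of finite rooted trees. -/
def UnlabeledRootedTree : Type 1 := Quotient RootedFinTree.isoSetoid

/-- The size of an unlabeled tree: its number of vertices. -/
noncomputable def UnlabeledTree.size : UnlabeledTree → ℕ :=
  Quotient.lift (fun T : FinTree => Nat.card T.V) fun _ _ ⟨φ⟩ => Nat.card_congr φ.toEquiv

/-- The size of an unlabeled rooted tree: its number of vertices. -/
noncomputable def UnlabeledRootedTree.size : UnlabeledRootedTree → ℕ :=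
  Quotient.lift (fun R : RootedFinTree => Nat.card R.tree.V)
    fun _ _ ⟨φ, _⟩ => Nat.card_congr φ.toEquiv

/-- The generating function `u(x)` of unlabeled unrooted trees. -/
noncomputable def unrootedGenFun : ℚ⟦X⟧ := sizeGenFun UnlabeledTree.size

/-- The generating function `r(x)` of unlabeled rooted trees. -/
noncomputable def rootedGenFun : ℚ⟦X⟧ := sizeGenFun UnlabeledRootedTree.size

/-- The formal power series `f(x ^ k) / k`, for `k ≥ 1`. -/
noncomputable def powerTerm (f : ℚ⟦X⟧) (k : ℕ+) : ℚ⟦X⟧ :=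
  ((k : ℕ) : ℚ)⁻¹ • PowerSeries.expand (k : ℕ) k.ne_zero f

/-! The basic operation is `graft a b`: join the roots of `a` and `b` by an edge and keep the root
of `a`. Crossing an edge with the root turns `graft a b` into `graft b a`, and a rooted tree is
determined by the multiset of its branches at the root.

For the first identity, order rooted trees by size, breaking ties arbitrarily, and push the root of
`graft a b` across the edge whenever `a` precedes `b`. Such a move is unique
(`graft_inj_of_size_le`) and the process stops (`wellFounded_reroots`). Its endpoint is unchanged
when the root crosses any edge, so each unlabeled tree has exactly one immovable rooting. The
movable rootings correspond to pairs `a` before `b`, that is, to unordered pairs of distinct rooted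
trees. If `p` counts these, then `r = u + p` and `r ^ 2 = 2 p + r(x ^ 2)`; eliminate `p`.

For the second identity, `r` is `x` times the generating function of multisets of rooted trees
(`childrenEquiv`). That function and the exponential both have constant term 1 and solve `x f' = f
L`, where `L` has coefficients `∑ d ∣ m, d * r_d`. The equation for multisets is the double count
`sum_card_multiset`; its solution is unique by recursion on coefficients. -/

instance (T : FinTree) : Finite T.V := T.finite

/-! ### Acyclicity of disjoint unions -/

namespace SimpleGraph

variable {V W : Type*} {G : SimpleGraph V} {H : SimpleGraph W}

theorem Reachable.of_adj_closed {P : V → Prop} (hP : ∀ a b, G.Adj a b → P a → P b)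
    {a b : V} (h : G.Reachable a b) (ha : P a) : P b := by
  obtain ⟨p⟩ := h
  induction p with
  | nil => exact ha
  | cons hab p ih => exact ih (hP _ _ hab ha)

/-- A path avoiding a given edge cannot leave its summand, so every bridge of a summand remains a
bridge of the union. -/
theorem IsAcyclic.sum (hG : G.IsAcyclic) (hH : H.IsAcyclic) : (G ⊕g H).IsAcyclic := by
  rw [isAcyclic_iff_forall_adj_isBridge]
  rintro (a | a) (b | b) hab
  · rw [isBridge_iff]
    intro h
    have := h.of_adj_closed (P := fun z => ∃ x, z = .inl x ∧
      (G.deleteEdges {s(a, b)}).Reachable a x) ?_ ⟨a, rfl, Reachable.rfl⟩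
    · obtain ⟨x, hx, hr⟩ := this
      cases hx
      exact isBridge_iff.1 (isAcyclic_iff_forall_adj_isBridge.1 hG (sum_adj_inl.1 hab)) hr
    · rintro _ z hz ⟨x, rfl, hr⟩
      rcases z with z | z
      · refine ⟨z, rfl, hr.trans (Adj.reachable ?_)⟩
        simpa [deleteEdges_adj] using hz
      · simp [deleteEdges_adj] at hz
  · simp at hab
  · simp at hab
  · rw [isBridge_iff]
    intro h
    have := h.of_adj_closed (P := fun z => ∃ x, z = .inr x ∧
      (H.deleteEdges {s(a, b)}).Reachable a x) ?_ ⟨a, rfl, Reachable.rfl⟩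
    · obtain ⟨x, hx, hr⟩ := this
      cases hx
      exact isBridge_iff.1 (isAcyclic_iff_forall_adj_isBridge.1 hH (sum_adj_inr.1 hab)) hr
    · rintro _ z hz ⟨x, rfl, hr⟩
      rcases z with z | z
      · simp [deleteEdges_adj] at hz
      · refine ⟨z, rfl, hr.trans (Adj.reachable ?_)⟩
        simpa [deleteEdges_adj] using hz

end SimpleGraph

/-! ### The two sides of an edge of a tree -/

namespace FinTree

/-- For adjacent vertices `v` and `w` of a tree: the component containing `w` that is left
after deleting the edge between `v` and `w`, rooted at `w`. -/
def side (T : FinTree) (v w : T.V) : RootedFinTree where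
  tree :=
    { V := (T.graph.deleteEdges {s(v, w)}).connectedComponentMk w
      finite := inferInstance
      graph := ((T.graph.deleteEdges {s(v, w)}).connectedComponentMk w).toSimpleGraph
      isTree := (T.isTree.isAcyclic.anti
        (SimpleGraph.deleteEdges_le _)).isTree_connectedComponent _ }
  root := ⟨w, rfl⟩

/-- The inclusion of a side of an edge in the whole tree. -/
def sideVal (T : FinTree) (v w : T.V) (x : (T.side v w).tree.V) : T.V := x.1

variable {T : FinTree} {v w : T.V}

theorem sideVal_injective : Function.Injective (T.sideVal v w) := Subtype.val_injective

@[simp] theorem sideVal_root : T.sideVal v w (T.side v w).root = w := rfl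

theorem mem_range_sideVal {u : T.V} : u ∈ Set.range (T.sideVal v w) ↔
    (T.graph.deleteEdges {s(v, w)}).Reachable w u := by
  constructor
  · rintro ⟨x, rfl⟩
    exact (SimpleGraph.ConnectedComponent.exact x.2).symm
  · intro h
    exact ⟨⟨u, (SimpleGraph.ConnectedComponent.sound h.symm)⟩, rfl⟩

theorem not_reachable_deleteEdges (h : T.graph.Adj v w) :
    ¬ (T.graph.deleteEdges {s(v, w)}).Reachable v w :=
  SimpleGraph.isBridge_iff.1 (SimpleGraph.isAcyclic_iff_forall_adj_isBridge.1 T.isTree.isAcyclic h)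

theorem sideVal_ne (h : T.graph.Adj v w) (x : (T.side v w).tree.V) : T.sideVal v w x ≠ v := by
  intro hx
  have := mem_range_sideVal.1 ⟨x, hx⟩
  exact not_reachable_deleteEdges h this.symm

theorem side_adj_iff (h : T.graph.Adj v w) (x y : (T.side v w).tree.V) :
    (T.side v w).tree.graph.Adj x y ↔ T.graph.Adj (T.sideVal v w x) (T.sideVal v w y) := by
  change (T.graph.deleteEdges {s(v, w)}).Adj (T.sideVal v w x) (T.sideVal v w y) ↔ _
  rw [SimpleGraph.deleteEdges_adj, and_iff_left]
  have hx := sideVal_ne h x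
  have hy := sideVal_ne h y
  simp only [Set.mem_singleton_iff, Sym2.eq_iff]
  tauto

theorem mem_range_sideVal_of_adj {u u' : T.V} (hu : u ∈ Set.range (T.sideVal v w))
    (ha : T.graph.Adj u u') (hne : ¬ (u = w ∧ u' = v)) (hv : u ≠ v) :
    u' ∈ Set.range (T.sideVal v w) := by
  rw [mem_range_sideVal] at *
  refine hu.trans (SimpleGraph.Adj.reachable ?_)
  rw [SimpleGraph.deleteEdges_adj]
  refine ⟨ha, ?_⟩
  simp only [Set.mem_singleton_iff, Sym2.eq_iff]
  tauto

theorem sideVal_adj (h : T.graph.Adj v w) {x : (T.side v w).tree.V} {u : T.V}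
    (ha : T.graph.Adj (T.sideVal v w x) u) :
    u ∈ Set.range (T.sideVal v w) ∨ T.sideVal v w x = w ∧ u = v := by
  by_cases hne : T.sideVal v w x = w ∧ u = v
  · exact .inr hne
  · exact .inl (mem_range_sideVal_of_adj ⟨x, rfl⟩ ha hne (sideVal_ne h x))

/-- A rooted tree embedded in `T` is isomorphic to a side of an edge if that edge is the only
one leaving its image. -/
theorem isomorphic_side (h : T.graph.Adj v w) (R : RootedFinTree) (f : R.tree.V → T.V)
    (hf : Function.Injective f) (hadj : ∀ x y, R.tree.graph.Adj x y ↔ T.graph.Adj (f x) (f y))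
    (hroot : f R.root = w) (hv : ∀ x, f x ≠ v)
    (hcl : ∀ x u, T.graph.Adj (f x) u → u ∈ Set.range f ∨ f x = w ∧ u = v) :
    R.Isomorphic (T.side v w) := by
  -- The image of `f` is connected and avoids `v`, so it lies in the component of `w`; conversely,
  -- by `hcl`, it cannot be left without using the deleted edge.
  have hsub : ∀ x, f x ∈ Set.range (T.sideVal v w) := by
    intro x
    rw [mem_range_sideVal]
    refine (R.tree.isTree.connected.preconnected R.root x).of_adj_closed
      (P := fun x => (T.graph.deleteEdges {s(v, w)}).Reachable w (f x))
      (fun a b hab ha => ha.trans (SimpleGraph.Adj.reachable ?_)) (hroot ▸ SimpleGraph.Reachable.rfl)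
    rw [SimpleGraph.deleteEdges_adj]
    refine ⟨(hadj _ _).1 hab, ?_⟩
    have := hv a
    have := hv b
    simp only [Set.mem_singleton_iff, Sym2.eq_iff]
    tauto
  have hsup : ∀ u, (T.graph.deleteEdges {s(v, w)}).Reachable w u → u ∈ Set.range f := by
    intro u hu
    refine hu.of_adj_closed (P := fun u => u ∈ Set.range f) ?_ ⟨_, hroot⟩
    rintro _ b hab ⟨x, rfl⟩
    rw [SimpleGraph.deleteEdges_adj] at hab
    refine (hcl x b hab.1).resolve_right ?_
    rintro ⟨h1, h2⟩
    exact hab.2 (by rw [h1, h2, Set.mem_singleton_iff, Sym2.eq_swap])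
  choose g hg using hsub
  have hbij : Function.Bijective g := by
    refine ⟨fun a b hab => hf (by rw [← hg a, ← hg b, hab]), fun y => ?_⟩
    obtain ⟨x, hx⟩ := hsup _ (mem_range_sideVal.1 ⟨y, rfl⟩)
    exact ⟨x, sideVal_injective ((hg x).trans hx)⟩
  refine ⟨⟨Equiv.ofBijective g hbij, ?_⟩, ?_⟩
  · intro a b
    rw [Equiv.ofBijective_apply, Equiv.ofBijective_apply, side_adj_iff h, hg, hg, hadj]
  · change g R.root = _
    exact sideVal_injective (by rw [hg, hroot, sideVal_root])

theorem side_isomorphic_side {T T' : FinTree} {v w : T.V} (h : T.graph.Adj v w)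
    (φ : T.graph ≃g T'.graph) : (T.side v w).Isomorphic (T'.side (φ v) (φ w)) := by
  refine isomorphic_side (φ.map_adj_iff.2 h) _ (fun x => φ (T.sideVal v w x))
    (φ.injective.comp sideVal_injective) (fun x y => ?_) rfl
    (fun x hx => sideVal_ne h x (φ.injective hx)) (fun x u hu => ?_)
  · rw [side_adj_iff h, φ.map_adj_iff]
  · obtain ⟨u, rfl⟩ := φ.surjective u
    rcases sideVal_adj h (φ.map_adj_iff.1 hu) with ⟨y, rfl⟩ | ⟨h1, h2⟩
    · exact .inl ⟨y, rfl⟩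
    · exact .inr ⟨by rw [h1], by rw [h2]⟩

end FinTree

/-- The isomorphism class of a rooted tree. -/
def UnlabeledRootedTree.mk (R : RootedFinTree) : UnlabeledRootedTree := Quotient.mk _ R

theorem UnlabeledRootedTree.sound {R S : RootedFinTree} (h : R.Isomorphic S) :
    UnlabeledRootedTree.mk R = UnlabeledRootedTree.mk S := Quotient.sound h

theorem UnlabeledRootedTree.mk_surjective : Function.Surjective UnlabeledRootedTree.mk :=
  Quotient.mk_surjective

/-! ### Joining rooted trees, and the branches at the root -/

namespace RootedFinTree

/-- The rooted tree obtained from two rooted trees by joining the roots by an edge,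
rooted at the root of the first one. -/
def graft (R S : RootedFinTree) : RootedFinTree where
  tree :=
    { V := R.tree.V ⊕ S.tree.V
      finite := inferInstance
      graph := (R.tree.graph ⊕g S.tree.graph) ⊔ SimpleGraph.edge (.inl R.root) (.inr S.root)
      isTree :=
        ⟨R.tree.isTree.connected.sum_sup_edge S.tree.isTree.connected,
          SimpleGraph.IsAcyclic.sup_edge_of_not_reachable
            (SimpleGraph.not_reachable_sum_inl_inr _ _)
            (R.tree.isTree.isAcyclic.sum S.tree.isTree.isAcyclic)⟩ }
  root := .inl R.root

variable {R S : RootedFinTree}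

/-- The inclusion of the first tree in the join. -/
def inl (R S : RootedFinTree) : R.tree.V → (R.graft S).tree.V := Sum.inl

/-- The inclusion of the second tree in the join. -/
def inr (R S : RootedFinTree) : S.tree.V → (R.graft S).tree.V := Sum.inr

theorem inl_injective : Function.Injective (R.inl S) := Sum.inl_injective

theorem inr_injective : Function.Injective (R.inr S) := Sum.inr_injective

theorem inl_ne_inr (x : R.tree.V) (y : S.tree.V) : R.inl S x ≠ R.inr S y := Sum.inl_ne_inr

theorem graft_cases (z : (R.graft S).tree.V) : (∃ x, z = R.inl S x) ∨ ∃ y, z = R.inr S y := by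
  rcases z with x | y
  · exact .inl ⟨x, rfl⟩
  · exact .inr ⟨y, rfl⟩

theorem graft_root : (R.graft S).root = R.inl S R.root := rfl

theorem graft_adj_inl_inl {x y : R.tree.V} :
    (R.graft S).tree.graph.Adj (R.inl S x) (R.inl S y) ↔ R.tree.graph.Adj x y := by
  simp [graft, SimpleGraph.edge_adj, inl]

theorem graft_adj_inr_inr {x y : S.tree.V} :
    (R.graft S).tree.graph.Adj (R.inr S x) (R.inr S y) ↔ S.tree.graph.Adj x y := by
  simp [graft, SimpleGraph.edge_adj, inr]

theorem graft_adj_inl_inr {x : R.tree.V} {y : S.tree.V} :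
    (R.graft S).tree.graph.Adj (R.inl S x) (R.inr S y) ↔ x = R.root ∧ y = S.root := by
  simp [graft, SimpleGraph.edge_adj, inl, inr]

theorem graft_adj_inr_inl {x : R.tree.V} {y : S.tree.V} :
    (R.graft S).tree.graph.Adj (R.inr S y) (R.inl S x) ↔ x = R.root ∧ y = S.root := by
  rw [SimpleGraph.adj_comm, graft_adj_inl_inr]

theorem card_graft : Nat.card (R.graft S).tree.V = Nat.card R.tree.V + Nat.card S.tree.V :=
  Nat.card_sum

/-- To give an isomorphism from a join to a rooted tree amounts to embedding both parts. -/
theorem graft_isomorphic {Q : RootedFinTree} (f : R.tree.V → Q.tree.V) (g : S.tree.V → Q.tree.V)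
    (hf : Function.Injective f) (hg : Function.Injective g) (hfg : ∀ x y, f x ≠ g y)
    (hsurj : ∀ z, z ∈ Set.range f ∨ z ∈ Set.range g)
    (hff : ∀ x y, R.tree.graph.Adj x y ↔ Q.tree.graph.Adj (f x) (f y))
    (hgg : ∀ x y, S.tree.graph.Adj x y ↔ Q.tree.graph.Adj (g x) (g y))
    (hadj : ∀ x y, Q.tree.graph.Adj (f x) (g y) ↔ x = R.root ∧ y = S.root) :
    ∃ φ : (R.graft S).tree.graph ≃g Q.tree.graph,
      (∀ x, φ (R.inl S x) = f x) ∧ ∀ y, φ (R.inr S y) = g y := by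
  let F : (R.graft S).tree.V → Q.tree.V := Sum.elim f g
  have hl : ∀ x, F (R.inl S x) = f x := fun _ => rfl
  have hr : ∀ y, F (R.inr S y) = g y := fun _ => rfl
  have hF : Function.Bijective F := by
    refine ⟨hf.sumElim hg hfg, fun z => ?_⟩
    rcases hsurj z with ⟨x, rfl⟩ | ⟨y, rfl⟩
    exacts [⟨_, hl x⟩, ⟨_, hr y⟩]
  refine ⟨⟨Equiv.ofBijective F hF, ?_⟩, hl, hr⟩
  intro a b
  simp only [Equiv.ofBijective_apply]
  rcases graft_cases a with ⟨a, rfl⟩ | ⟨a, rfl⟩ <;> rcases graft_cases b with ⟨b, rfl⟩ | ⟨b, rfl⟩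
  · rw [hl, hl, graft_adj_inl_inl, hff]
  · rw [hl, hr, graft_adj_inl_inr, hadj]
  · rw [hl, hr, graft_adj_inr_inl, SimpleGraph.adj_comm, hadj]
  · rw [hr, hr, graft_adj_inr_inr, hgg]

theorem graft_congr {R' S' : RootedFinTree} (hR : R.Isomorphic R') (hS : S.Isomorphic S') :
    (R.graft S).Isomorphic (R'.graft S') := by
  obtain ⟨φ, hφ⟩ := hR
  obtain ⟨ψ, hψ⟩ := hS
  obtain ⟨χ, hχ, -⟩ := graft_isomorphic (R := R) (S := S) (Q := R'.graft S')
    (fun x => R'.inl S' (φ x)) (fun y => R'.inr S' (ψ y)) (inl_injective.comp φ.injective)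
    (inr_injective.comp ψ.injective) (fun _ _ => inl_ne_inr _ _)
    (fun z => by
      rcases graft_cases z with ⟨a, rfl⟩ | ⟨a, rfl⟩
      · exact .inl ⟨φ.symm a, by simp⟩
      · exact .inr ⟨ψ.symm a, by simp⟩)
    (fun x y => by rw [graft_adj_inl_inl, φ.map_adj_iff])
    (fun x y => by rw [graft_adj_inr_inr, ψ.map_adj_iff])
    (fun x y => by rw [graft_adj_inl_inr, ← hφ, ← hψ, φ.injective.eq_iff, ψ.injective.eq_iff])
  exact ⟨χ, by rw [graft_root, graft_root, hχ, hφ]⟩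

theorem graft_comm (R S : RootedFinTree) : (R.graft S).tree.Isomorphic (S.graft R).tree := by
  obtain ⟨χ, -⟩ := graft_isomorphic (R := R) (S := S) (Q := S.graft R) (S.inr R) (S.inl R)
    inr_injective inl_injective (fun _ _ => (inl_ne_inr _ _).symm)
    (fun z => by
      rcases graft_cases z with ⟨a, rfl⟩ | ⟨a, rfl⟩
      · exact .inr ⟨a, rfl⟩
      · exact .inl ⟨a, rfl⟩)
    (fun x y => by rw [graft_adj_inr_inr]) (fun x y => by rw [graft_adj_inl_inl])
    (fun x y => by rw [graft_adj_inr_inl, and_comm])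
  exact ⟨χ⟩

theorem isomorphic_graft_side {T : FinTree} {v w : T.V} (h : T.graph.Adj v w) :
    ((T.side w v).graft (T.side v w)).Isomorphic ⟨T, v⟩ := by
  -- A common vertex would connect `v` to `w` after deletion of the edge, which is a bridge.
  have hdisj : ∀ x y, T.sideVal w v x ≠ T.sideVal v w y := by
    intro x y hxy
    have h1 := FinTree.mem_range_sideVal.1 ⟨x, rfl⟩
    have h2 := FinTree.mem_range_sideVal.1 ⟨y, rfl⟩
    rw [Sym2.eq_swap, hxy] at h1
    exact FinTree.not_reachable_deleteEdges h (h1.trans h2.symm)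
  obtain ⟨χ, hχ, -⟩ := graft_isomorphic (R := T.side w v) (S := T.side v w) (Q := ⟨T, v⟩)
    (T.sideVal w v) (T.sideVal v w) FinTree.sideVal_injective FinTree.sideVal_injective hdisj
    (fun z => by
      -- The union of the two sides is closed under adjacency, hence is everything by connectedness.
      refine (T.isTree.connected.preconnected v z).of_adj_closed
        (P := fun z => z ∈ Set.range (T.sideVal w v) ∨ z ∈ Set.range (T.sideVal v w)) ?_
        (.inl ⟨(T.side w v).root, rfl⟩)
      rintro _ b hab (⟨x, rfl⟩ | ⟨y, rfl⟩)
      · rcases FinTree.sideVal_adj h.symm hab with hb | ⟨-, rfl⟩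
        exacts [.inl hb, .inr ⟨(T.side v b).root, rfl⟩]
      · rcases FinTree.sideVal_adj h hab with hb | ⟨-, rfl⟩
        exacts [.inr hb, .inl ⟨(T.side w b).root, rfl⟩])
    (fun x y => FinTree.side_adj_iff h.symm x y) (fun x y => FinTree.side_adj_iff h x y)
    (fun x y => by
      constructor
      · intro hxy
        have hx : T.sideVal w v x = v ∧ T.sideVal v w y = w := by
          rcases FinTree.sideVal_adj h.symm hxy with ⟨z, hz⟩ | hx
          · exact (hdisj _ _ hz).elim
          · exact hx
        exact ⟨FinTree.sideVal_injective hx.1, FinTree.sideVal_injective hx.2⟩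
      · rintro ⟨rfl, rfl⟩
        exact h)
  exact ⟨χ, by rw [graft_root, hχ]; rfl⟩

theorem side_graft_inr : ((R.graft S).tree.side (R.inl S R.root) (R.inr S S.root)).Isomorphic S := by
  refine RootedFinTree.isoSetoid.symm (FinTree.isomorphic_side
    (graft_adj_inl_inr.2 ⟨rfl, rfl⟩) S (R.inr S) inr_injective
    (fun x y => graft_adj_inr_inr.symm) rfl (fun x => (inl_ne_inr _ _).symm) (fun x u hu => ?_))
  rcases graft_cases u with ⟨a, rfl⟩ | ⟨a, rfl⟩
  · obtain ⟨rfl, rfl⟩ := graft_adj_inr_inl.1 hu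
    exact .inr ⟨rfl, rfl⟩
  · exact .inl ⟨a, rfl⟩

theorem side_graft_inl {w : R.tree.V} (h : R.tree.graph.Adj R.root w) :
    ((R.graft S).tree.side (R.inl S R.root) (R.inl S w)).Isomorphic (R.tree.side R.root w) := by
  refine RootedFinTree.isoSetoid.symm (FinTree.isomorphic_side
    (graft_adj_inl_inl.2 h) _ (fun x => R.inl S (R.tree.sideVal _ _ x))
    (inl_injective.comp FinTree.sideVal_injective)
    (fun x y => by rw [graft_adj_inl_inl, FinTree.side_adj_iff h]) rfl
    (fun x hx => FinTree.sideVal_ne h x (inl_injective hx)) (fun x u hu => ?_))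
  rcases graft_cases u with ⟨a, rfl⟩ | ⟨a, rfl⟩
  · rcases FinTree.sideVal_adj h (graft_adj_inl_inl.1 hu) with ⟨y, rfl⟩ | ⟨h1, h2⟩
    · exact .inl ⟨y, rfl⟩
    · exact .inr ⟨by rw [h1], by rw [h2]⟩
  · exact (FinTree.sideVal_ne h x (graft_adj_inl_inr.1 hu).1).elim

/-- The multiset of isomorphism classes of the branches at the root. -/
noncomputable def children (R : RootedFinTree) : Multiset UnlabeledRootedTree :=
  (Set.toFinite (R.tree.graph.neighborSet R.root)).toFinset.val.map
    fun w => UnlabeledRootedTree.mk (R.tree.side R.root w)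

theorem mem_children {R : RootedFinTree} {b : UnlabeledRootedTree} :
    b ∈ R.children ↔ ∃ w, R.tree.graph.Adj R.root w ∧
      UnlabeledRootedTree.mk (R.tree.side R.root w) = b := by
  simp [children]

theorem children_congr {R R' : RootedFinTree} (h : R.Isomorphic R') :
    R.children = R'.children := by
  obtain ⟨φ, hφ⟩ := h
  have hs : (Set.toFinite (R'.tree.graph.neighborSet R'.root)).toFinset =
      (Set.toFinite (R.tree.graph.neighborSet R.root)).toFinset.map φ.toEquiv.toEmbedding := by
    ext w
    obtain ⟨w, rfl⟩ := φ.surjective w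
    rw [Set.Finite.mem_toFinset, SimpleGraph.mem_neighborSet, ← hφ, φ.map_adj_iff]
    exact ⟨fun h => Finset.mem_map.2 ⟨w, by simpa using h, rfl⟩, fun h => by
      obtain ⟨w', hw', h⟩ := Finset.mem_map.1 h
      rw [← φ.injective h]
      simpa using hw'⟩
  rw [children, children, hs, Finset.map_val, Multiset.map_map]
  refine Multiset.map_congr rfl fun w hw => ?_
  have hw' : R.tree.graph.Adj R.root w := by simpa using hw
  refine UnlabeledRootedTree.sound ?_
  rw [← hφ]
  exact FinTree.side_isomorphic_side hw' φ

/-- The root gains one neighbor, whose branch is `S`. The old branches are unchanged, because `S` is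
attached at the root and so lies outside each of them. -/
theorem children_graft (R S : RootedFinTree) :
    (R.graft S).children = UnlabeledRootedTree.mk S ::ₘ R.children := by
  have hs : (Set.toFinite ((R.graft S).tree.graph.neighborSet (R.graft S).root)).toFinset =
      Finset.cons (R.inr S S.root)
        ((Set.toFinite (R.tree.graph.neighborSet R.root)).toFinset.map ⟨R.inl S, inl_injective⟩)
        (by simp [inl_ne_inr]) := by
    ext w
    rcases graft_cases w with ⟨a, rfl⟩ | ⟨a, rfl⟩
    · simp [graft_root, graft_adj_inl_inl, inl_ne_inr]
    · simp [graft_root, graft_adj_inl_inr, inl_ne_inr, inr_injective.eq_iff]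
  rw [children, children, hs, Finset.cons_val, Multiset.map_cons, Finset.map_val,
    Multiset.map_map]
  congr 1
  · exact UnlabeledRootedTree.sound side_graft_inr
  · refine Multiset.map_congr rfl fun w hw => ?_
    exact UnlabeledRootedTree.sound (side_graft_inl (by simpa using hw))

end RootedFinTree

/-! ### Grafting and rerooting of isomorphism classes -/

namespace UnlabeledRootedTree

/-- Joining the roots of two unlabeled rooted trees by an edge. -/
def graft : UnlabeledRootedTree → UnlabeledRootedTree → UnlabeledRootedTree :=
  Quotient.map₂ RootedFinTree.graft fun _ _ h _ _ h' => RootedFinTree.graft_congr h h'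

/-- The multiset of branches at the root. -/
noncomputable def children : UnlabeledRootedTree → Multiset UnlabeledRootedTree :=
  Quotient.lift RootedFinTree.children fun _ _ h => RootedFinTree.children_congr h

/-- Forgetting the root. -/
def unroot : UnlabeledRootedTree → UnlabeledTree :=
  Quotient.map RootedFinTree.tree fun _ _ ⟨φ, _⟩ => ⟨φ⟩

/-- The tree with one vertex. -/
def leaf : UnlabeledRootedTree :=
  mk ⟨⟨Unit, inferInstance, ⊥, SimpleGraph.IsTree.of_subsingleton⟩, ()⟩

theorem size_graft (a b : UnlabeledRootedTree) : (graft a b).size = a.size + b.size := by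
  obtain ⟨R, rfl⟩ := mk_surjective a
  obtain ⟨S, rfl⟩ := mk_surjective b
  exact RootedFinTree.card_graft

theorem size_leaf : leaf.size = 1 := Nat.card_unique

theorem size_pos (a : UnlabeledRootedTree) : 0 < a.size := by
  obtain ⟨R, rfl⟩ := mk_surjective a
  have : Nonempty R.tree.V := ⟨R.root⟩
  exact Nat.card_pos

theorem size_unroot (a : UnlabeledRootedTree) : a.unroot.size = a.size := by
  obtain ⟨R, rfl⟩ := mk_surjective a
  rfl

theorem children_graft (a b : UnlabeledRootedTree) :
    (graft a b).children = b ::ₘ a.children := by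
  obtain ⟨R, rfl⟩ := mk_surjective a
  obtain ⟨S, rfl⟩ := mk_surjective b
  exact RootedFinTree.children_graft R S

theorem children_leaf : leaf.children = 0 :=
  Multiset.eq_zero_of_forall_notMem fun _ hb => by
    obtain ⟨w, hw, -⟩ := RootedFinTree.mem_children.1 hb
    exact hw.ne rfl

theorem exists_eq_graft_of_mem_children {a b : UnlabeledRootedTree} (h : b ∈ a.children) :
    ∃ c, a = graft c b := by
  obtain ⟨R, rfl⟩ := mk_surjective a
  obtain ⟨w, hw, rfl⟩ := RootedFinTree.mem_children.1 h
  exact ⟨mk (R.tree.side w R.root),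
    (sound (RootedFinTree.isomorphic_graft_side hw)).symm⟩

theorem eq_leaf_of_children_eq_zero {a : UnlabeledRootedTree} (h : a.children = 0) :
    a = leaf := by
  obtain ⟨R, rfl⟩ := mk_surjective a
  have hno : ∀ w, ¬ R.tree.graph.Adj R.root w := by
    intro w hw
    have : mk (R.tree.side R.root w) ∈ R.children :=
      RootedFinTree.mem_children.2 ⟨w, hw, rfl⟩
    rw [show R.children = 0 from h] at this
    exact Multiset.notMem_zero _ this
  have huniq : ∀ x, x = R.root := fun x =>
    (R.tree.isTree.connected.preconnected R.root x).of_adj_closed (P := (· = R.root))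
      (fun a b hab ha => (hno b (ha ▸ hab)).elim) rfl
  refine sound ⟨⟨⟨fun _ => (), fun _ => R.root, fun x => (huniq x).symm,
    fun _ => rfl⟩, ?_⟩, rfl⟩
  intro a b
  rw [huniq a, huniq b]
  exact iff_of_false (fun h => h.ne rfl) (fun h => h.ne rfl)

theorem unroot_surjective : Function.Surjective unroot := by
  intro t
  induction t using Quotient.inductionOn with
  | h T =>
    obtain ⟨v⟩ := T.isTree.connected.nonempty
    exact ⟨mk ⟨T, v⟩, rfl⟩

theorem unroot_graft_comm (a b : UnlabeledRootedTree) :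
    (graft a b).unroot = (graft b a).unroot := by
  obtain ⟨R, rfl⟩ := mk_surjective a
  obtain ⟨S, rfl⟩ := mk_surjective b
  exact Quotient.sound (RootedFinTree.graft_comm R S)

/-- Two rootings of one tree are linked by a path, and each edge of the path only swaps the
arguments of a graft. So invariants of rootings need checking only on swaps. -/
theorem eq_of_unroot_eq {X : Type*} (f : UnlabeledRootedTree → X)
    (hf : ∀ a b, f (graft a b) = f (graft b a)) {a b : UnlabeledRootedTree}
    (h : a.unroot = b.unroot) : f a = f b := by
  obtain ⟨R, rfl⟩ := mk_surjective a
  obtain ⟨S, rfl⟩ := mk_surjective b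
  obtain ⟨φ⟩ : R.tree.Isomorphic S.tree := Quotient.exact h
  have h1 : mk R = mk ⟨S.tree, φ R.root⟩ :=
    sound ⟨φ, rfl⟩
  rw [h1]
  refine (S.tree.isTree.connected.preconnected (φ R.root) S.root).of_adj_closed
    (P := fun v => f (mk ⟨S.tree, φ R.root⟩) = f (mk ⟨S.tree, v⟩))
    (fun v w hvw ih => ih.trans ?_) rfl
  have e1 : mk ⟨S.tree, v⟩ = graft (mk _) (mk _) :=
    (sound (RootedFinTree.isomorphic_graft_side hvw)).symm
  have e2 : mk ⟨S.tree, w⟩ = graft (mk _) (mk _) :=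
    (sound (RootedFinTree.isomorphic_graft_side hvw.symm)).symm
  rw [e1, e2]
  exact hf _ _

end UnlabeledRootedTree

/-! ### Rooted trees as multisets of branches; finiteness -/

namespace UnlabeledRootedTree

theorem size_lt_of_mem_children {a b : UnlabeledRootedTree} (h : b ∈ a.children) :
    b.size < a.size := by
  obtain ⟨c, rfl⟩ := exists_eq_graft_of_mem_children h
  have := c.size_pos
  rw [size_graft]
  omega

theorem eq_leaf_or_graft (a : UnlabeledRootedTree) : a = leaf ∨ ∃ b c, a = graft b c := by
  rcases Multiset.empty_or_exists_mem a.children with h | ⟨c, hc⟩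
  · exact .inl (eq_leaf_of_children_eq_zero h)
  · obtain ⟨b, hb⟩ := exists_eq_graft_of_mem_children hc
    exact .inr ⟨b, c, hb⟩

@[elab_as_elim]
theorem graft_induction {P : UnlabeledRootedTree → Prop} (leaf : P leaf)
    (graft : ∀ a b, P a → P b → P (graft a b)) (a : UnlabeledRootedTree) : P a := by
  induction hn : a.size using Nat.strong_induction_on generalizing a with
  | _ n ih =>
    rcases eq_leaf_or_graft a with rfl | ⟨b, c, rfl⟩
    · exact leaf
    · have hb := b.size_pos
      have hc := c.size_pos
      rw [size_graft] at hn
      exact graft b c (ih _ (by omega) b rfl) (ih _ (by omega) c rfl)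

/-- A branch common to both trees can be split off, leaving smaller trees whose remaining branches
still agree. -/
theorem children_injective : Function.Injective children := by
  intro a
  induction a using graft_induction with
  | leaf => exact fun b h => (eq_leaf_of_children_eq_zero (h.symm.trans children_leaf)).symm
  | graft a b iha _ =>
    intro c h
    rw [children_graft] at h
    obtain ⟨d, rfl⟩ := exists_eq_graft_of_mem_children (h ▸ Multiset.mem_cons_self b _)
    rw [children_graft, Multiset.cons_inj_right] at h
    rw [iha h]

theorem children_surjective : Function.Surjective children := by
  intro m
  induction m using Multiset.induction_on with
  | empty => exact ⟨leaf, children_leaf⟩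
  | cons b m ih =>
    obtain ⟨a, rfl⟩ := ih
    exact ⟨graft a b, children_graft a b⟩

/-- An unlabeled rooted tree is the same thing as the multiset of its branches at the root. -/
noncomputable def childrenEquiv : UnlabeledRootedTree ≃ Multiset UnlabeledRootedTree :=
  Equiv.ofBijective children ⟨children_injective, children_surjective⟩

theorem size_eq_sum_children_add_one (a : UnlabeledRootedTree) :
    a.size = (a.children.map size).sum + 1 := by
  induction a using graft_induction with
  | leaf => rw [size_leaf, children_leaf, Multiset.map_zero, Multiset.sum_zero]
  | graft a b iha _ =>
    rw [size_graft, children_graft, Multiset.map_cons, Multiset.sum_cons, iha]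
    omega

/-- Every tree other than `leaf` is a graft of two strictly smaller trees. -/
theorem finite_size_lt (n : ℕ) : {a : UnlabeledRootedTree | a.size < n}.Finite := by
  induction n with
  | zero => simp
  | succ n ih =>
    refine ((ih.image2 graft ih).insert leaf).subset fun a ha => ?_
    rcases eq_leaf_or_graft a with rfl | ⟨b, c, rfl⟩
    · exact Set.mem_insert _ _
    · have hb := b.size_pos
      have hc := c.size_pos
      rw [Set.mem_ofPred_eq, size_graft] at ha
      exact .inr ⟨b, by rw [Set.mem_ofPred_eq]; omega, c, by rw [Set.mem_ofPred_eq]; omega, rfl⟩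

instance finite_size_eq (n : ℕ) : Finite {a : UnlabeledRootedTree // a.size = n} :=
  ((finite_size_lt (n + 1)).subset fun _ (h : _ = n) => h ▸ Nat.lt_succ_self _).to_subtype

instance _root_.UnlabeledTree.finite_size_eq (n : ℕ) : Finite {t : UnlabeledTree // t.size = n} :=
  Finite.of_surjective
    (fun a : {a : UnlabeledRootedTree // a.size = n} =>
      (⟨a.1.unroot, (size_unroot a.1).trans a.2⟩ : {t : UnlabeledTree // t.size = n}))
    fun ⟨t, ht⟩ => by
      obtain ⟨a, rfl⟩ := unroot_surjective t
      exact ⟨⟨a, (size_unroot a).symm.trans ht⟩, rfl⟩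

/-! ### Moving the root towards the larger branch -/

/-- A strict total order on unlabeled rooted trees refining the order by size. -/
def Prec (a b : UnlabeledRootedTree) : Prop :=
  a.size < b.size ∨ a.size = b.size ∧ WellOrderingRel a b

theorem Prec.size_le {a b : UnlabeledRootedTree} (h : Prec a b) : a.size ≤ b.size :=
  h.elim le_of_lt fun h => h.1.le

theorem Prec.asymm {a b : UnlabeledRootedTree} (h : Prec a b) : ¬ Prec b a := by
  rintro (h' | ⟨h', hw'⟩)
  · exact h'.not_ge h.size_le
  · rcases h with h | ⟨-, hw⟩
    · omega
    · exact _root_.asymm hw hw'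

theorem prec_trichotomy (a b : UnlabeledRootedTree) : Prec a b ∨ a = b ∨ Prec b a := by
  rcases lt_trichotomy a.size b.size with h | h | h
  · exact .inl (.inl h)
  · rcases trichotomous_of WellOrderingRel a b with hw | hw | hw
    · exact .inl (.inr ⟨h, hw⟩)
    · exact .inr (.inl hw)
    · exact .inr (.inr (.inr ⟨h.symm, hw⟩))
  · exact .inr (.inr (.inl h))

/-- If the split-off branches were different ones, `d` would be a branch of `a` and `b` a branch of
`c`, giving the cycle of sizes `d < a ≤ b < c ≤ d`. This makes the possible move of the root unique.
-/
theorem graft_inj_of_size_le {a b c d : UnlabeledRootedTree} (h : graft a b = graft c d)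
    (hab : a.size ≤ b.size) (hcd : c.size ≤ d.size) : a = c ∧ b = d := by
  have hch := congrArg children h
  rw [children_graft, children_graft] at hch
  rcases Multiset.cons_eq_cons.1 hch with ⟨hbd, hac⟩ | ⟨-, m, ha, hc⟩
  · exact ⟨children_injective hac, hbd⟩
  · have h1 := size_lt_of_mem_children (a := a) (b := d) (by simp [ha])
    have h2 := size_lt_of_mem_children (a := c) (b := b) (by simp [hc])
    omega

/-- `Reroots y x` means that `y` is obtained from `x` by moving the root to a neighbor whose
branch is larger than the rest of the tree. -/
def Reroots (y x : UnlabeledRootedTree) : Prop :=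
  ∃ a b, Prec a b ∧ x = graft a b ∧ y = graft b a

theorem Reroots.eq_of_graft {a b y : UnlabeledRootedTree} (h : Reroots y (graft a b))
    (hab : Prec a b) : y = graft b a := by
  obtain ⟨c, d, hcd, he, rfl⟩ := h
  obtain ⟨rfl, rfl⟩ := graft_inj_of_size_le he hab.size_le hcd.size_le
  rfl

theorem acc_reroots_graft {a b : UnlabeledRootedTree} (hab : Prec a b) :
    Acc Reroots (graft a b) := by
  induction hn : b.size using Nat.strong_induction_on generalizing a b with
  | _ n ih =>
    refine Acc.intro _ fun y hy => ?_
    rw [hy.eq_of_graft hab]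
    refine Acc.intro _ fun z hz => ?_
    have hz' := hz
    obtain ⟨c, d, hcd, he, -⟩ := hz'
    have hch := congrArg children he
    rw [children_graft, children_graft] at hch
    -- The next move cannot go back across the same edge, since `Prec` is asymmetric. It therefore
    -- enters a branch `d` of `b`, which is smaller than `b`.
    rcases Multiset.cons_eq_cons.1 hch with ⟨rfl, hbc⟩ | ⟨-, m, hb, -⟩
    · rw [← children_injective hbc] at hcd
      exact (hab.asymm hcd).elim
    · have h1 := size_lt_of_mem_children (a := b) (b := d) (by simp [hb])
      rw [he] at hz
      exact (ih _ (hn ▸ h1) hcd rfl).inv hz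

theorem wellFounded_reroots : WellFounded Reroots :=
  ⟨fun x => Acc.intro x fun y hy => by
    have hy' := hy
    obtain ⟨a, b, hab, rfl, -⟩ := hy'
    exact (acc_reroots_graft hab).inv hy⟩

open Classical in
/-- The result of moving the root to a neighbor with a larger branch as long as possible. -/
noncomputable def canonicalRoot : UnlabeledRootedTree → UnlabeledRootedTree :=
  wellFounded_reroots.fix fun x f => if h : ∃ y, Reroots y x then f h.choose h.choose_spec else x

theorem canonicalRoot_of_not_exists {x : UnlabeledRootedTree} (h : ¬ ∃ y, Reroots y x) :
    canonicalRoot x = x := by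
  rw [canonicalRoot, WellFounded.fix_eq, dif_neg h]

theorem canonicalRoot_graft {a b : UnlabeledRootedTree} (hab : Prec a b) :
    canonicalRoot (graft a b) = canonicalRoot (graft b a) := by
  have h : ∃ y, Reroots y (graft a b) := ⟨_, a, b, hab, rfl, rfl⟩
  -- The successor picked by choice must be `graft b a`, as there is only one.
  rw [← h.choose_spec.eq_of_graft hab]
  conv_lhs => rw [canonicalRoot, WellFounded.fix_eq, dif_pos h]
  rfl

theorem canonicalRoot_graft_comm (a b : UnlabeledRootedTree) :
    canonicalRoot (graft a b) = canonicalRoot (graft b a) := by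
  rcases prec_trichotomy a b with h | rfl | h
  · exact canonicalRoot_graft h
  · rfl
  · exact (canonicalRoot_graft h).symm

theorem canonicalRoot_spec (x : UnlabeledRootedTree) :
    (¬ ∃ y, Reroots y (canonicalRoot x)) ∧ (canonicalRoot x).unroot = x.unroot := by
  induction x using wellFounded_reroots.induction with
  | _ x ih =>
    by_cases h : ∃ y, Reroots y x
    · obtain ⟨y, hy⟩ := h
      have := ih y hy
      obtain ⟨a, b, hab, rfl, rfl⟩ := hy
      rwa [canonicalRoot_graft hab, unroot_graft_comm a b]
    · rw [canonicalRoot_of_not_exists h]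
      exact ⟨h, rfl⟩

/-- Every unlabeled tree has exactly one root position from which the root cannot be moved. -/
noncomputable def unrootEquiv : {x // ¬ ∃ y, Reroots y x} ≃ UnlabeledTree :=
  Equiv.ofBijective (fun x => unroot x.1) <| by
    constructor
    · rintro ⟨x, hx⟩ ⟨y, hy⟩ h
      -- The canonical root depends only on the unrooted tree, and it fixes immovable rootings.
      have := eq_of_unroot_eq canonicalRoot canonicalRoot_graft_comm h
      rw [canonicalRoot_of_not_exists hx, canonicalRoot_of_not_exists hy] at this
      exact Subtype.ext this
    · intro t
      obtain ⟨x, rfl⟩ := unroot_surjective t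
      exact ⟨⟨_, (canonicalRoot_spec x).1⟩, (canonicalRoot_spec x).2⟩

/-- The rooted trees whose root can be moved correspond to the pairs of distinct rooted trees. -/
noncomputable def graftEquiv :
    {p : UnlabeledRootedTree × UnlabeledRootedTree // Prec p.1 p.2} ≃ {x // ∃ y, Reroots y x} :=
  Equiv.ofBijective (fun p => ⟨graft p.1.1 p.1.2, _, _, _, p.2, rfl, rfl⟩) <| by
    constructor
    · rintro ⟨⟨a, b⟩, hab⟩ ⟨⟨c, d⟩, hcd⟩ h
      obtain ⟨rfl, rfl⟩ := graft_inj_of_size_le (congrArg Subtype.val h) hab.size_le hcd.size_le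
      rfl
    · rintro ⟨_, _, a, b, hab, rfl, rfl⟩
      exact ⟨⟨(a, b), hab⟩, rfl⟩

end UnlabeledRootedTree

/-! ### Sums, products and diagonals of generating functions -/

section sizeGenFun

variable {A B : Type*} {s : A → ℕ} {t : B → ℕ}

theorem sizeGenFun_congr (e : A ≃ B) (h : ∀ a, t (e a) = s a) : sizeGenFun s = sizeGenFun t := by
  ext n
  rw [sizeGenFun, sizeGenFun, PowerSeries.coeff_mk, PowerSeries.coeff_mk]
  exact congrArg _ (Nat.card_congr (e.subtypeEquiv fun a => by rw [h]))

theorem finite_sumElim_eq (hs : ∀ n, Finite {a // s a = n}) (ht : ∀ n, Finite {b // t b = n})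
    (n : ℕ) : Finite {x // Sum.elim s t x = n} :=
  Finite.of_equiv ({a // s a = n} ⊕ {b // t b = n})
    (Equiv.subtypeSum (p := fun x => Sum.elim s t x = n)).symm

theorem sizeGenFun_sumElim (hs : ∀ n, Finite {a // s a = n}) (ht : ∀ n, Finite {b // t b = n}) :
    sizeGenFun (Sum.elim s t) = sizeGenFun s + sizeGenFun t := by
  ext n
  simp only [sizeGenFun, PowerSeries.coeff_mk, map_add]
  rw [← Nat.cast_add, ← Nat.card_sum]
  exact congrArg _ (Nat.card_congr Equiv.subtypeSum)

theorem sizeGenFun_prod (hs : ∀ n, Finite {a // s a = n}) (ht : ∀ n, Finite {b // t b = n}) :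
    sizeGenFun (fun p : A × B => s p.1 + t p.2) = sizeGenFun s * sizeGenFun t := by
  ext n
  rw [PowerSeries.coeff_mul]
  simp only [sizeGenFun, PowerSeries.coeff_mk]
  rw [← Finset.sum_coe_sort]
  simp_rw [← Nat.cast_mul, ← Nat.card_prod]
  rw [← Nat.cast_sum, ← Nat.card_sigma]
  refine congrArg _ (Nat.card_congr
    ⟨fun p => ⟨⟨(s p.1.1, t p.1.2), Finset.HasAntidiagonal.mem_antidiagonal.2 p.2⟩, ⟨p.1.1, rfl⟩, ⟨p.1.2, rfl⟩⟩,
      fun q => ⟨(q.2.1.1, q.2.2.1), ?_⟩, fun p => rfl, ?_⟩)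
  · rw [q.2.1.2, q.2.2.2]
    exact Finset.HasAntidiagonal.mem_antidiagonal.1 q.1.2
  · rintro ⟨⟨⟨i, j⟩, hij⟩, ⟨a, ha⟩, ⟨b, hb⟩⟩
    obtain rfl : i = s a := ha.symm
    obtain rfl : j = t b := hb.symm
    rfl

theorem sizeGenFun_two_mul (s : A → ℕ) :
    sizeGenFun (fun a => s a + s a) = PowerSeries.expand 2 two_ne_zero (sizeGenFun s) := by
  ext n
  rw [PowerSeries.coeff_expand]
  simp only [sizeGenFun, PowerSeries.coeff_mk]
  split_ifs with h
  · obtain ⟨m, rfl⟩ := h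
    refine congrArg _ (Nat.card_congr (Equiv.subtypeEquivRight fun a => ?_))
    omega
  · have : IsEmpty {a // s a + s a = n} := ⟨fun a => h ⟨s a.1, a.2.symm.trans (two_mul _).symm⟩⟩
    simp

end sizeGenFun

/-! ### The identity for unrooted trees -/

namespace UnlabeledRootedTree

theorem finite_pair_size_eq (n : ℕ) :
    Finite {p : UnlabeledRootedTree × UnlabeledRootedTree // p.1.size + p.2.size = n} :=
  (((finite_size_lt (n + 1)).prod (finite_size_lt (n + 1))).subset
    fun p (h : p.1.size + p.2.size = n) =>
      ⟨show p.1.size < n + 1 by omega, show p.2.size < n + 1 by omega⟩).to_subtype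

/-- The generating function of pairs of distinct unlabeled rooted trees. -/
noncomputable def pairGenFun : ℚ⟦X⟧ :=
  sizeGenFun fun p : {p : UnlabeledRootedTree × UnlabeledRootedTree // Prec p.1 p.2} =>
    p.1.1.size + p.1.2.size

theorem finite_prec_size_eq (n : ℕ) :
    Finite {p : {p : UnlabeledRootedTree × UnlabeledRootedTree // Prec p.1 p.2} //
      p.1.1.size + p.1.2.size = n} := by
  have := finite_pair_size_eq n
  exact Finite.of_injective
    (fun p => (⟨p.1.1, p.2⟩ : {p : UnlabeledRootedTree × UnlabeledRootedTree //
      p.1.size + p.2.size = n}))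
    fun p q h => Subtype.ext (Subtype.ext (congrArg (fun x => x.1) h))

/-- A root is either immovable, which gives one rooting per unlabeled tree, or movable, which gives
one pair `Prec a b`. -/
theorem rootedGenFun_eq_add : rootedGenFun = unrootedGenFun + pairGenFun := by
  classical
  rw [rootedGenFun, unrootedGenFun, pairGenFun,
    ← sizeGenFun_sumElim UnlabeledTree.finite_size_eq finite_prec_size_eq]
  refine (sizeGenFun_congr ((Equiv.sumComm _ _).trans ((graftEquiv.sumCongr
    unrootEquiv.symm).trans (Equiv.sumCompl fun x => ∃ y, Reroots y x))) ?_).symm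
  rintro (t | p)
  · obtain ⟨x, rfl⟩ := unrootEquiv.surjective t
    simp only [Equiv.trans_apply, Equiv.sumComm_apply, Sum.swap_inl, Equiv.sumCongr_apply,
      Sum.map_inr, Equiv.symm_apply_apply, Equiv.sumCompl_apply_inr, Sum.elim_inl]
    exact (size_unroot _).symm
  · exact size_graft _ _

/-- By trichotomy an ordered pair is increasing, decreasing or diagonal; the diagonal contributes
`r(x ^ 2)`. -/
theorem rootedGenFun_sq :
    rootedGenFun ^ 2 = pairGenFun + pairGenFun + PowerSeries.expand 2 two_ne_zero rootedGenFun := by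
  rw [sq, rootedGenFun, ← sizeGenFun_prod finite_size_eq finite_size_eq, ← sizeGenFun_two_mul,
    pairGenFun, ← sizeGenFun_sumElim finite_prec_size_eq finite_prec_size_eq,
    ← sizeGenFun_sumElim]
  · refine (sizeGenFun_congr (Equiv.ofBijective
      (Sum.elim (Sum.elim (fun p => p.1) fun p => p.1.swap) fun a => (a, a)) ⟨?_, ?_⟩) ?_).symm
    · have hirr : ∀ a : UnlabeledRootedTree, ¬ Prec a a := fun a h => h.asymm h
      refine Function.Injective.sumElim (Function.Injective.sumElim Subtype.val_injective
        (Prod.swap_injective.comp Subtype.val_injective) ?_) ?_ ?_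
      · rintro ⟨⟨a, b⟩, hab⟩ ⟨⟨c, d⟩, hcd⟩ h
        cases h
        exact hab.asymm hcd
      · intro a b h
        exact congrArg Prod.fst h
      · rintro (⟨⟨a, b⟩, hab⟩ | ⟨⟨a, b⟩, hab⟩) c h <;> cases h <;> exact hirr _ hab
    · rintro ⟨a, b⟩
      rcases prec_trichotomy a b with h | rfl | h
      · exact ⟨.inl (.inl ⟨(a, b), h⟩), rfl⟩
      · exact ⟨.inr a, rfl⟩
      · exact ⟨.inl (.inr ⟨(b, a), h⟩), rfl⟩
    · rintro ((p | p) | a)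
      · rfl
      · exact add_comm _ _
      · rfl
  · exact finite_sumElim_eq finite_prec_size_eq finite_prec_size_eq
  · intro n
    have := finite_pair_size_eq n
    exact Finite.of_injective
      (fun a : {a : UnlabeledRootedTree // a.size + a.size = n} =>
        (⟨(a.1, a.1), a.2⟩ : {p : UnlabeledRootedTree × UnlabeledRootedTree //
          p.1.size + p.2.size = n}))
      fun a b h => Subtype.ext (congrArg (fun p => p.1.1) h)

theorem unrootedGenFun_eq : unrootedGenFun = rootedGenFun -
    (1 / 2 : ℚ) • (rootedGenFun ^ 2 - PowerSeries.expand 2 two_ne_zero rootedGenFun) := by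
  rw [rootedGenFun_sq, add_sub_cancel_right, rootedGenFun_eq_add, ← two_smul ℚ pairGenFun,
    smul_smul]
  norm_num

end UnlabeledRootedTree

/-! ### Logarithmic derivatives and the series in the exponent -/

open PowerSeries in
/-- The solution of `x f' = f L` with given constant term is unique. -/
theorem PowerSeries.eq_of_X_mul_derivative_eq {f g L : ℚ⟦X⟧} (hL : constantCoeff L = 0)
    (hf : X * d⁄dX ℚ f = f * L) (hg : X * d⁄dX ℚ g = g * L)
    (h0 : constantCoeff f = constantCoeff g) : f = g := by
  have key : ∀ h : ℚ⟦X⟧, X * d⁄dX ℚ h = h * L → ∀ n : ℕ,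
      coeff (n + 1) h * (n + 1) = ∑ p ∈ Finset.HasAntidiagonal.antidiagonal (n + 1), coeff p.1 h * coeff p.2 L := by
    intro h hh n
    rw [← coeff_mul, ← hh, coeff_succ_X_mul, coeff_derivative]
  ext n
  induction n using Nat.strong_induction_on with
  | _ n ih =>
    rcases n with _ | n
    · rwa [coeff_zero_eq_constantCoeff_apply, coeff_zero_eq_constantCoeff_apply]
    · refine mul_right_cancel₀ (b := (n + 1 : ℚ)) (by positivity) ?_
      rw [key f hf, key g hg]
      refine Finset.sum_congr rfl fun p hp => ?_
      rw [Finset.HasAntidiagonal.mem_antidiagonal] at hp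
      -- The term containing the unknown coefficient `n + 1` is multiplied by the constant term of
      -- `L`, which is 0; all others are known by induction.
      rcases Nat.eq_zero_or_pos p.2 with h2 | h2
      · rw [h2, coeff_zero_eq_constantCoeff_apply, hL, mul_zero, mul_zero]
      · rw [ih p.1 (by omega)]

section powerTerm

open PowerSeries

/-- The sum of the series `f(x ^ k) / k`. -/
noncomputable def powerSum (f : ℚ⟦X⟧) : ℚ⟦X⟧ :=
  PowerSeries.mk fun m => ∑ k ∈ m.divisors, (k : ℚ)⁻¹ * coeff (m / k) f

theorem hasSum_powerTerm {f : ℚ⟦X⟧} (hf : constantCoeff f = 0) :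
    HasSum (powerTerm f) (powerSum f) := by
  rw [PowerSeries.WithPiTopology.hasSum_iff_hasSum_coeff]
  intro m
  have h := hasSum_sum_of_ne_finset_zero (L := .unconditional ℕ) (s := m.divisors)
    (f := fun k => if k ∈ m.divisors then (k : ℚ)⁻¹ * coeff (m / k) f else 0)
    (fun k hk => if_neg hk)
  rw [Finset.sum_congr rfl fun k hk => if_pos hk] at h
  rw [powerSum, coeff_mk]
  refine (((PNat.coe_injective.hasSum_iff ?_).2 h).congr_fun ?_)
  · intro k hk
    refine if_neg fun hk' => hk ⟨⟨k, Nat.pos_of_mem_divisors hk'⟩, rfl⟩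
  · intro k
    simp only [Function.comp_apply, powerTerm, coeff_smul, coeff_expand, smul_eq_mul,
      Nat.mem_divisors]
    -- For `m = 0` every `k` divides `m` while `Nat.divisors 0` is empty; both sides vanish because
    -- `f` has no constant term.
    rcases eq_or_ne m 0 with rfl | hm
    · simp [hf]
    · simp [hm]

theorem constantCoeff_powerSum (f : ℚ⟦X⟧) : constantCoeff (powerSum f) = 0 := by
  rw [← coeff_zero_eq_constantCoeff_apply, powerSum, coeff_mk, Nat.divisors_zero, Finset.sum_empty]

/-- The operator `x d/dx` multiplies the coefficient at `m` by `m`, and `m / k` is the complementary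
divisor `d`, so the denominators cancel. -/
theorem X_mul_derivative_powerSum (f : ℚ⟦X⟧) :
    X * d⁄dX ℚ (powerSum f) = PowerSeries.mk fun m => ∑ d ∈ m.divisors, (d : ℚ) * coeff d f := by
  ext m
  rcases m with _ | m
  · simp
  · rw [coeff_succ_X_mul, coeff_derivative, powerSum, coeff_mk, coeff_mk,
      ← Nat.sum_div_divisors, Finset.sum_mul]
    refine Finset.sum_congr rfl fun k hk => ?_
    have hk0 : (k : ℚ) ≠ 0 := by exact_mod_cast (Nat.pos_of_mem_divisors hk).ne'
    rw [Nat.cast_div (Nat.dvd_of_mem_divisors hk) hk0]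
    rw [Nat.div_div_self (Nat.dvd_of_mem_divisors hk) m.succ_ne_zero]
    push_cast
    field_simp

end powerTerm

/-! ### Multisets and the exponential -/

section multiset

variable {A : Type*} {s : A → ℕ}

/-- Double count of triples `(M, a, k)` with `1 ≤ k ≤ M.count a`, weighted by `s a`. For fixed `M`
the weights add up to the total size `n`; removing `k` copies of `a` leaves an arbitrary smaller
multiset, and the removed size `k * s a` is a multiple of `d = s a`. -/
theorem sum_card_multiset (hs : ∀ a, 0 < s a) (𝓐 : ℕ → Finset A) (h𝓐 : ∀ n a, a ∈ 𝓐 n ↔ s a = n)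
    (𝓜 : ℕ → Finset (Multiset A)) (h𝓜 : ∀ n M, M ∈ 𝓜 n ↔ (M.map s).sum = n) (n : ℕ) :
    n * (𝓜 n).card = ∑ p ∈ Finset.HasAntidiagonal.antidiagonal n,
      (𝓜 p.1).card * ∑ d ∈ p.2.divisors, d * (𝓐 d).card := by
  classical
  have h1 : n * (𝓜 n).card = ∑ M ∈ 𝓜 n, ∑ a ∈ M.toFinset, ∑ k ∈ Finset.Icc 1 (M.count a), s a := by
    rw [mul_comm, ← smul_eq_mul, ← Finset.sum_const]
    refine Finset.sum_congr rfl fun M hM => ?_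
    rw [← (h𝓜 n M).1 hM, Finset.sum_multiset_map_count]
    simp
  have h2 : ∀ p : ℕ × ℕ, (𝓜 p.1).card * ∑ d ∈ p.2.divisors, d * (𝓐 d).card =
      ∑ d ∈ p.2.divisors, ∑ a ∈ 𝓐 d, ∑ M ∈ 𝓜 p.1, d := by
    intro p
    rw [Finset.mul_sum]
    refine Finset.sum_congr rfl fun d _ => ?_
    simp only [Finset.sum_const, smul_eq_mul]
    ring
  rw [h1, Finset.sum_congr rfl fun p _ => h2 p]
  simp only [Finset.sum_sigma']
  have hle : ∀ (M : Multiset A) (a : A) (k : ℕ), k ≤ M.count a →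
      ((M - Multiset.replicate k a).map s).sum + k * s a = (M.map s).sum := by
    intro M a k hk
    have := Multiset.le_count_iff_replicate_le.1 hk
    conv_rhs => rw [← Multiset.sub_add_cancel this]
    simp
  refine Finset.sum_bij'
    (fun x _ => ⟨(n - x.2.2 * s x.2.1, x.2.2 * s x.2.1), s x.2.1, x.2.1,
      x.1 - Multiset.replicate x.2.2 x.2.1⟩)
    -- The number of removed copies is recovered as removed size divided by `d`.
    (fun y _ => ⟨y.2.2.2 + Multiset.replicate (y.1.2 / y.2.1) y.2.2.1, y.2.2.1,
      y.1.2 / y.2.1⟩) ?_ ?_ ?_ ?_ ?_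
  · rintro ⟨M, a, k⟩ hx
    simp only [Finset.mem_sigma, h𝓜, Multiset.mem_toFinset, Finset.mem_Icc] at hx
    obtain ⟨hM, ha, hk1, hk⟩ := hx
    have := hle M a k hk
    have hsa := hs a
    simp only [Finset.mem_sigma, h𝓜, h𝓐, Finset.HasAntidiagonal.mem_antidiagonal, Nat.mem_divisors]
    exact ⟨by omega, ⟨dvd_mul_left _ _, by positivity⟩, trivial, by omega⟩
  · rintro ⟨⟨i, m⟩, d, a, M⟩ hy
    simp only [Finset.mem_sigma, h𝓜, h𝓐, Finset.HasAntidiagonal.mem_antidiagonal, Nat.mem_divisors] at hy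
    obtain ⟨him, ⟨hdm, hm⟩, rfl, rfl⟩ := hy
    have hsa := hs a
    have hk : 0 < m / s a := Nat.div_pos (Nat.le_of_dvd (by omega) hdm) hsa
    simp only [Finset.mem_sigma, h𝓜, Multiset.mem_toFinset, Finset.mem_Icc, Multiset.mem_add,
      Multiset.mem_replicate, Multiset.map_add, Multiset.map_replicate, Multiset.sum_add,
      Multiset.sum_replicate, smul_eq_mul, Nat.div_mul_cancel hdm, Multiset.count_add,
      Multiset.count_replicate_self]
    exact ⟨him, .inr ⟨hk.ne', trivial⟩, hk, by omega⟩
  · rintro ⟨M, a, k⟩ hx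
    simp only [Finset.mem_sigma, h𝓜, Multiset.mem_toFinset, Finset.mem_Icc] at hx
    simp only [Nat.mul_div_cancel _ (hs a),
      Multiset.sub_add_cancel (Multiset.le_count_iff_replicate_le.1 hx.2.2.2)]
  · rintro ⟨⟨i, m⟩, d, a, M⟩ hy
    simp only [Finset.mem_sigma, h𝓜, h𝓐, Finset.HasAntidiagonal.mem_antidiagonal, Nat.mem_divisors] at hy
    obtain ⟨him, ⟨hdm, hm⟩, rfl, rfl⟩ := hy
    simp only [Nat.div_mul_cancel hdm, Multiset.add_sub_cancel_right]
    congr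
    omega
  · rintro ⟨M, a, k⟩ hx
    rfl

open PowerSeries in
/-- The generating function of the multisets of objects of a class. -/
theorem sizeGenFun_multiset (hs : ∀ a, 0 < s a) (hfin : ∀ n, Finite {a // s a = n})
    (hfin' : ∀ n, Finite {M : Multiset A // (M.map s).sum = n}) :
    sizeGenFun (fun M : Multiset A => (M.map s).sum) =
      (PowerSeries.exp ℚ).subst (powerSum (sizeGenFun s)) := by
  have hsub : HasSubst (powerSum (sizeGenFun s)) :=
    HasSubst.of_constantCoeff_zero' (constantCoeff_powerSum _)
  refine eq_of_X_mul_derivative_eq (L := X * d⁄dX ℚ (powerSum (sizeGenFun s))) (by simp) ?_ ?_ ?_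
  · have hA : ∀ n, {a | s a = n}.Finite := fun n => hfin n
    have hM : ∀ n, {M : Multiset A | (M.map s).sum = n}.Finite := fun n => hfin' n
    have key := sum_card_multiset hs (fun n => (hA n).toFinset) (by simp)
      (fun n => (hM n).toFinset) (by simp)
    have cA : ∀ n, coeff n (sizeGenFun s) = ((hA n).toFinset.card : ℚ) := fun n => by
      rw [sizeGenFun, coeff_mk, ← Set.ncard_eq_toFinset_card _ (hA n)]; rfl
    have cM : ∀ n, coeff n (sizeGenFun fun M : Multiset A => (M.map s).sum) =
        ((hM n).toFinset.card : ℚ) := fun n => by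
      rw [sizeGenFun, coeff_mk, ← Set.ncard_eq_toFinset_card _ (hM n)]; rfl
    rw [X_mul_derivative_powerSum]
    ext n
    rcases n with _ | n
    · simp
    · rw [coeff_succ_X_mul, coeff_derivative, coeff_mul, mul_comm]
      simp only [coeff_mk, cA, cM]
      exact_mod_cast key (n + 1)
  · rw [derivative_subst hsub, derivative_exp]
    ring
  -- Both constant terms are 1: since sizes are positive, only the empty multiset has size 0.
  · have hzero : ∀ M : Multiset A, (M.map s).sum = 0 ↔ M = 0 := by
      intro M
      refine ⟨fun h => Multiset.eq_zero_of_forall_notMem fun a ha => ?_, fun h => by simp [h]⟩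
      exact (hs a).ne' (Multiset.sum_eq_zero_iff.1 h _ (Multiset.mem_map_of_mem s ha))
    rw [← coeff_zero_eq_constantCoeff_apply, sizeGenFun, coeff_mk]
    simp only [hzero, Nat.card_unique, Nat.cast_one]
    symm
    refine (constantCoeff_subst hsub _).trans ?_
    rw [finsum_eq_single _ 0 fun d hd => ?_]
    · simp
    · have : MvPowerSeries.constantCoeff (powerSum (sizeGenFun s)) = 0 :=
        constantCoeff_powerSum _
      rw [map_pow, this, zero_pow hd, smul_zero]

end multiset

/-! ### The functional equation for rooted trees -/

namespace UnlabeledRootedTree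

/-- The factor `X` accounts for the root; the remaining vertices are those of the branches. -/
theorem rootedGenFun_eq_X_mul_multiset : rootedGenFun =
    PowerSeries.X * sizeGenFun fun M : Multiset UnlabeledRootedTree => (M.map size).sum := by
  ext n
  rcases n with _ | n
  · have : IsEmpty {a : UnlabeledRootedTree // a.size = 0} := ⟨fun a => a.1.size_pos.ne' a.2⟩
    simp [rootedGenFun, sizeGenFun]
  · rw [PowerSeries.coeff_succ_X_mul, rootedGenFun, sizeGenFun, sizeGenFun, PowerSeries.coeff_mk,
      PowerSeries.coeff_mk]
    refine congrArg _ (Nat.card_congr (childrenEquiv.subtypeEquiv fun a => ?_))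
    rw [size_eq_sum_children_add_one, Nat.add_right_cancel_iff]
    rfl

theorem finite_multiset_size_eq (n : ℕ) :
    Finite {M : Multiset UnlabeledRootedTree // (M.map size).sum = n} :=
  Finite.of_equiv {a : UnlabeledRootedTree // a.size = n + 1} (childrenEquiv.subtypeEquiv fun a => by
    rw [size_eq_sum_children_add_one, Nat.add_right_cancel_iff]
    rfl)

theorem constantCoeff_rootedGenFun : PowerSeries.constantCoeff rootedGenFun = 0 := by
  rw [rootedGenFun_eq_X_mul_multiset]
  simp

end UnlabeledRootedTree

open UnlabeledRootedTree in
theorem mainTheorem2 :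
    -- there are only finitely many unlabeled trees and rooted trees of each size
    (∀ n : ℕ, Finite {t : UnlabeledTree // t.size = n}) ∧
    (∀ n : ℕ, Finite {t : UnlabeledRootedTree // t.size = n}) ∧
    -- `u(x) = r(x) - (r(x) ^ 2 - r(x ^ 2)) / 2`
    unrootedGenFun = rootedGenFun -
      (1 / 2 : ℚ) • (rootedGenFun ^ 2 - PowerSeries.expand 2 two_ne_zero rootedGenFun) ∧
    -- the sum of the `r(x ^ k) / k` over `k ≥ 1` converges, can be substituted into `exp`,
    -- and `r(x) = x * exp (∑ r(x ^ k) / k)`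
    Summable (powerTerm rootedGenFun) ∧
    PowerSeries.HasSubst (∑' k : ℕ+, powerTerm rootedGenFun k) ∧
    rootedGenFun = PowerSeries.X *
      (PowerSeries.exp ℚ).subst (∑' k : ℕ+, powerTerm rootedGenFun k) := by
  have h := hasSum_powerTerm constantCoeff_rootedGenFun
  rw [h.tsum_eq]
  refine ⟨UnlabeledTree.finite_size_eq, finite_size_eq, unrootedGenFun_eq, h.summable,
    PowerSeries.HasSubst.of_constantCoeff_zero' (constantCoeff_powerSum _), ?_⟩
  conv_lhs => rw [rootedGenFun_eq_X_mul_multiset,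
    sizeGenFun_multiset size_pos finite_size_eq finite_multiset_size_eq]
  rfl
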